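/- Let $m\ge 0$ and $n\ge 1$ be integers with $m<n/2$, let $\Sigma_n$ denote the group of permutations of $\{1,\dots,n\}$, and regard $\Sigma_{n-1}$ as the subgroup of $\Sigma_n$ fixing the letter $n$ (so $\Sigma_0$ is the trivial group). Then the homomorphism $H_m(\Sigma_{n-1};\mathbb{Z})\to H_m(\Sigma_n;\mathbb{Z})$ on group homology with trivial integer coefficients induced by the inclusion $\Sigma_{n-1}\hookrightarrow\Sigma_n$ is an isomorphism. -/

import Mathlib

open CategoryTheory

/-- The symmetric group `Σ_n`: all permutations of a set with `n` elements. -/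
abbrev SymGroup (n : ℕ) : Type := Equiv.Perm (Fin n)

/-- The standard inclusion `Σ_k → Σ_n` for `k ≤ n`: a permutation of the first `k` letters is
extended by the identity on the remaining `n - k` letters. -/
noncomputable def symInclusion {k n : ℕ} (h : k ≤ n) : SymGroup k →* SymGroup n :=
  Equiv.Perm.viaEmbeddingHom (Fin.castLEEmb h)

/-- On the first `k` letters the extended permutation acts as the given one. -/
theorem symInclusion_castLE {k n : ℕ} (h : k ≤ n) (σ : SymGroup k) (i : Fin k) :
    symInclusion h σ (Fin.castLE h i) = Fin.castLE h (σ i) :=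
  Equiv.Perm.viaEmbedding_apply σ (Fin.castLEEmb h) i

/-- The letters after the first `k` are fixed. -/
theorem symInclusion_of_le {k n : ℕ} (h : k ≤ n) (σ : SymGroup k) (i : Fin n) (hi : k ≤ i) :
    symInclusion h σ i = i := by
  refine Equiv.Perm.viaEmbedding_apply_of_notMem σ (Fin.castLEEmb h) i ?_
  rintro ⟨j, rfl⟩
  exact absurd j.isLt (not_lt.mpr hi)

/-- Integral group homology `H_m(G) = H_m(G, ℤ)`, with `G` acting trivially on `ℤ`. -/
noncomputable abbrev integralHomology (G : Type) [Group G] (m : ℕ) : ModuleCat ℤ :=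
  groupHomology (Rep.trivial ℤ G ℤ) m

/-- The identity of `ℤ`, as a morphism from the trivial representation of `G` to the restriction
along `f : G → H` of the trivial representation of `H`. -/
def trivialToRes {G H : Type} [Group G] [Group H] (f : G →* H) :
    Rep.trivial ℤ G ℤ ⟶ Rep.res f (Rep.trivial ℤ H ℤ) :=
  Rep.ofHom ⟨LinearMap.id, fun _ => rfl⟩

/-- The map `H_m(G) → H_m(H)` on integral homology induced by a group homomorphism `f : G → H`
and the identity of `ℤ`. -/
noncomputable def integralHomologyMap {G H : Type} [Group G] [Group H] (f : G →* H) (m : ℕ) :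
    integralHomology G m ⟶ integralHomology H m :=
  groupHomology.map f (trivialToRes f) m

/-! Let `C_l` be the free abelian group on words of `l` distinct letters from `n`, with the
alternating sum of letter deletions as differential. This complex is exact in lengths below `n`
(`injectiveWords_exact`), and `Σ_n` acts on it. The action on words of length `l` is transitive with
stabilizer `Σ_{n-l}`, so Shapiro's lemma (`isIso_map_toPermuted`) gives `H_q(Σ_n; C_l) ≅
H_q(Σ_{n-l})`. The faces of a word differ by permutations commuting with its stabilizer, and inner
automorphisms act trivially on homology (`map_conj`). Hence all `l + 1` faces induce the same
stabilization map, and `C_{l+1} → C_l` induces that map for `l` even and zero for `l` odd.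

The theorem follows by induction on `m`. In place of a spectral sequence, the complex is cut into
short exact sequences `0 → B_{l+1} → C_{l+1} → B_l → 0` of images. Stability in degrees `q < m`
makes `H_q(B_l) → H_q(C_l)` injective in a range (`mono_map_imageι`). This kills the connecting maps
that could obstruct `H_m(C_1) → H_m(C_0)` from being an isomorphism, and `C_0` is the trivial
representation (`isIso_map_differential_zero`). -/

section Words

/-! ### Exactness of the complex of injective words. -/

variable {α : Type*}

/-- Prefixing every word with the word `p`. -/
noncomputable def wordPrefix (p : List α) : (List α →₀ ℤ) →ₗ[ℤ] (List α →₀ ℤ) :=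
  Finsupp.lmapDomain ℤ ℤ (p ++ ·)

/-- The part of a chain of words consisting of the words with prefix `p`, with `p` removed. -/
noncomputable def wordStrip (p : List α) : (List α →₀ ℤ) →ₗ[ℤ] (List α →₀ ℤ) :=
  Finsupp.lcomapDomain (p ++ ·) (List.append_right_injective p)

/-- The alternating sum of the words obtained by deleting one letter. -/
noncomputable def wordBoundarySingle : List α → (List α →₀ ℤ)
  | [] => 0
  | b :: w => Finsupp.single w 1 - wordPrefix [b] (wordBoundarySingle w)

/-- The boundary operator of the complex of words. -/
noncomputable def wordBoundary : (List α →₀ ℤ) →ₗ[ℤ] (List α →₀ ℤ) :=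
  Finsupp.linearCombination ℤ wordBoundarySingle

@[simp] lemma wordPrefix_single (p w : List α) (c : ℤ) :
    wordPrefix p (Finsupp.single w c) = Finsupp.single (p ++ w) c := by
  simp [wordPrefix]

lemma wordStrip_apply (p : List α) (z : List α →₀ ℤ) (v : List α) :
    wordStrip p z v = z (p ++ v) := rfl

lemma wordPrefix_cons (b : α) (p : List α) (z : List α →₀ ℤ) :
    wordPrefix (b :: p) z = wordPrefix [b] (wordPrefix p z) := by
  simp only [wordPrefix, Finsupp.lmapDomain_apply, ← Finsupp.mapDomain_comp]
  rfl

lemma wordPrefix_apply_append (p : List α) (z : List α →₀ ℤ) (v : List α) :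
    wordPrefix p z (p ++ v) = z v :=
  Finsupp.mapDomain_apply (List.append_right_injective p) z v

lemma wordPrefix_apply_of_not_prefix {p w : List α} (h : ¬ p <+: w) (z : List α →₀ ℤ) :
    wordPrefix p z w = 0 :=
  Finsupp.mapDomain_of_notMem_range z w fun ⟨v, hv⟩ => h ⟨v, hv⟩

@[simp] lemma wordBoundary_single (w : List α) (c : ℤ) :
    wordBoundary (Finsupp.single w c) = c • wordBoundarySingle w := by
  simp [wordBoundary]

/-- Prefixing a letter contracts the complex of all words. It contracts injective words only where
the letter is absent, which is why exactness needs a further argument. -/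
lemma wordBoundary_prefix_singleton (b : α) (z : List α →₀ ℤ) :
    wordBoundary (wordPrefix [b] z) = z - wordPrefix [b] (wordBoundary z) := by
  induction z using Finsupp.induction_linear with
  | zero => simp
  | add x y hx hy => simp only [map_add, hx, hy]; abel
  | single w c => simp [wordBoundarySingle, smul_sub]

lemma wordBoundary_wordBoundary (z : List α →₀ ℤ) : wordBoundary (wordBoundary z) = 0 := by
  have h : ∀ w : List α, wordBoundary (wordBoundarySingle w) = 0 := by
    intro w
    induction w with
    | nil => simp [wordBoundarySingle]
    | cons b w ih =>
      rw [wordBoundarySingle, map_sub, wordBoundary_prefix_singleton, ih]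
      simp
  induction z using Finsupp.induction_linear with
  | zero => simp
  | add x y hx hy => simp only [map_add, hx, hy, add_zero]
  | single w c => simp [h]

lemma wordStrip_single_cons_of_ne {b c : α} (h : b ≠ c) (p w : List α) (k : ℤ) :
    wordStrip (b :: p) (Finsupp.single (c :: w) k) = 0 := by
  ext v
  simp [wordStrip_apply, h.symm]

lemma wordStrip_cons_prefix_of_ne {b c : α} (h : b ≠ c) (p : List α) (z : List α →₀ ℤ) :
    wordStrip (b :: p) (wordPrefix [c] z) = 0 := by
  ext v
  rw [wordStrip_apply, wordPrefix_apply_of_not_prefix]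
  · rfl
  · simp [h.symm]

lemma wordStrip_cons_prefix (b : α) (p : List α) (z : List α →₀ ℤ) :
    wordStrip (b :: p) (wordPrefix [b] z) = wordStrip p z := by
  ext v
  rw [wordStrip_apply, wordStrip_apply, ← wordPrefix_apply_append [b] z]
  rfl

lemma wordStrip_single_eq_zero {p w : List α} (h : ¬ p <+: w) (k : ℤ) :
    wordStrip p (Finsupp.single w k) = 0 := by
  ext v
  rw [wordStrip_apply, Finsupp.single_eq_of_ne]
  · rfl
  · rintro rfl; exact h ⟨v, rfl⟩

lemma mem_drop_of_prefix {a : α} {u w : List α} (h : u ++ [a] <+: w) : a ∈ w.drop u.length := by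
  obtain ⟨v, rfl⟩ := h
  simp

/-- Deleting one of the first `u.length + 1` letters moves a later letter, hence not `a`, into the
place where the prefix requires `a`. Only deletions behind the prefix survive, and they carry the
sign `(-1) ^ (u.length + 1)`. -/
lemma wordStrip_boundarySingle (a : α) (u w : List α) (h : a ∉ w.drop (u.length + 1)) :
    wordStrip (u ++ [a]) (wordBoundarySingle w) =
      (-1 : ℤ) ^ (u.length + 1) • wordBoundary (wordStrip (u ++ [a]) (Finsupp.single w 1)) := by
  induction u generalizing w with
  | nil =>
    cases w with
    | nil => rw [wordStrip_single_eq_zero (by simp)]; simp [wordBoundarySingle]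
    | cons c w =>
      have h' : a ∉ w := by simpa using h
      have h0 : wordStrip [a] (Finsupp.single w (1 : ℤ)) = 0 :=
        wordStrip_single_eq_zero (fun hp => h' (hp.subset (by simp))) _
      have hs : ∀ z : List α →₀ ℤ, wordStrip [] z = z := fun z => by ext; rfl
      by_cases hac : a = c
      · subst hac
        have e : Finsupp.single (a :: w) (1 : ℤ) = wordPrefix [a] (Finsupp.single w 1) := by simp
        simp only [List.nil_append, wordBoundarySingle, map_sub, h0, wordStrip_cons_prefix, hs, e]
        simp
      · simp [wordBoundarySingle, h0, wordStrip_cons_prefix_of_ne hac,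
          wordStrip_single_cons_of_ne hac]
  | cons b u ih =>
    cases w with
    | nil => rw [wordStrip_single_eq_zero (by simp)]; simp [wordBoundarySingle]
    | cons c w =>
      have h' : a ∉ w.drop (u.length + 1) := by simpa using h
      have h0 : wordStrip (b :: (u ++ [a])) (Finsupp.single w (1 : ℤ)) = 0 :=
        wordStrip_single_eq_zero (fun hp => h' (mem_drop_of_prefix (u := b :: u) hp)) _
      by_cases hbc : b = c
      · subst hbc
        have e : Finsupp.single (b :: w) (1 : ℤ) = wordPrefix [b] (Finsupp.single w 1) := by simp
        simp only [List.cons_append, wordBoundarySingle, map_sub, h0, wordStrip_cons_prefix, ih w h',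
          e, List.length_cons]
        rw [zero_sub, ← neg_smul]
        congr 1
        ring
      · simp [wordBoundarySingle, h0, wordStrip_cons_prefix_of_ne hbc,
          wordStrip_single_cons_of_ne hbc]

/-- Chains of words without the letter `a` from position `s` on. -/
noncomputable def wordsAvoidingFrom (a : α) (s : ℕ) : Submodule ℤ (List α →₀ ℤ) :=
  Finsupp.supported ℤ ℤ {w | a ∉ w.drop s}

/-- Chains of injective words of length `l` with letters in `S`. -/
noncomputable def injectiveWords (S : Finset α) (l : ℕ) : Submodule ℤ (List α →₀ ℤ) :=
  Finsupp.supported ℤ ℤ {w | w.Nodup ∧ (∀ x ∈ w, x ∈ S) ∧ w.length = l}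

lemma induction_supported {s : Set (List α)} {P : (List α →₀ ℤ) → Prop} (h0 : P 0)
    (hadd : ∀ x y, P x → P y → P (x + y)) (hs : ∀ w ∈ s, ∀ c : ℤ, P (Finsupp.single w c))
    {z : List α →₀ ℤ} (hz : z ∈ Finsupp.supported ℤ ℤ s) : P z := by
  rw [Finsupp.mem_supported] at hz
  rw [← Finsupp.sum_single z, Finsupp.sum]
  exact Finset.sum_induction _ P hadd h0 fun w hw => hs w (hz hw) _

lemma map_supported_le {s : Set (List α)} {N : Submodule ℤ (List α →₀ ℤ)}
    (f : (List α →₀ ℤ) →ₗ[ℤ] (List α →₀ ℤ)) (h : ∀ w ∈ s, f (Finsupp.single w 1) ∈ N)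
    {z : List α →₀ ℤ} (hz : z ∈ Finsupp.supported ℤ ℤ s) : f z ∈ N := by
  refine induction_supported (P := fun z => f z ∈ N) (by simp)
    (fun x y hx hy => by simpa using N.add_mem hx hy) (fun w hw c => ?_) hz
  have : Finsupp.single w c = c • Finsupp.single w (1 : ℤ) := by simp
  rw [this, map_smul]
  exact N.smul_mem _ (h w hw)

lemma wordStrip_boundary {a : α} {u : List α} {z : List α →₀ ℤ}
    (hz : z ∈ wordsAvoidingFrom a (u.length + 1)) :
    wordStrip (u ++ [a]) (wordBoundary z) =
      (-1 : ℤ) ^ (u.length + 1) • wordBoundary (wordStrip (u ++ [a]) z) := by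
  refine induction_supported (P := fun z => wordStrip (u ++ [a]) (wordBoundary z) =
      (-1 : ℤ) ^ (u.length + 1) • wordBoundary (wordStrip (u ++ [a]) z))
    (by simp) (fun x y hx hy => by simp [hx, hy]) (fun w hw c => ?_) hz
  have : Finsupp.single w c = c • Finsupp.single w (1 : ℤ) := by simp
  rw [this]
  simp only [map_smul, wordBoundary_single, one_smul, wordStrip_boundarySingle a u w hw]
  rw [smul_comm]

/-- The difference consists of the deletions inside `p`. These leave `s` letters in front of `v`,
and `v` does not contain `a`. -/
lemma wordBoundary_prefix_single_sub_mem (a : α) (p v : List α) (s : ℕ) (hp : p.length = s + 1)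
    (h : a ∉ v) :
    wordBoundary (wordPrefix p (Finsupp.single v 1)) -
      (-1 : ℤ) ^ (s + 1) • wordPrefix p (wordBoundary (Finsupp.single v 1)) ∈
        wordsAvoidingFrom a s := by
  induction p generalizing s with
  | nil => simp at hp
  | cons b p ih =>
    rw [wordPrefix_cons, wordBoundary_prefix_singleton]
    have h1 : wordPrefix p (Finsupp.single v 1) ∈ wordsAvoidingFrom a s := by
      rw [wordPrefix_single]
      refine Finsupp.single_mem_supported ℤ _ ?_
      have : p.length = s := by simpa using hp
      simp [← this, h]
    have e : wordPrefix (b :: p) (wordBoundary (Finsupp.single v 1)) =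
      wordPrefix [b] (wordPrefix p (wordBoundary (Finsupp.single v 1))) := wordPrefix_cons _ _ _
    rw [e]
    rcases s with _ | s
    · have : p = [] := by simpa using hp
      subst this
      have e0 : ∀ z : List α →₀ ℤ, wordPrefix [] z = z := fun z => by
        exact Finsupp.mapDomain_id
      simpa [e0] using h1
    · have hpre : ∀ z ∈ wordsAvoidingFrom a s, wordPrefix [b] z ∈ wordsAvoidingFrom a (s + 1) :=
        fun z hz => map_supported_le _ (fun w hw => by
          rw [wordPrefix_single]
          exact Finsupp.single_mem_supported ℤ _ (by simpa using hw)) hz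
      have h2 := hpre _ (ih s (by simpa using hp))
      have := (wordsAvoidingFrom a (s + 1)).sub_mem h1 h2
      convert this using 1
      simp only [map_sub, map_smul, pow_succ]
      module

lemma wordBoundary_prefix_sub_mem {a : α} {u : List α} {y : List α →₀ ℤ}
    (hy : y ∈ wordsAvoidingFrom a 0) :
    wordBoundary (wordPrefix (u ++ [a]) y) -
      (-1 : ℤ) ^ (u.length + 1) • wordPrefix (u ++ [a]) (wordBoundary y) ∈
        wordsAvoidingFrom a u.length :=
  map_supported_le (wordBoundary ∘ₗ wordPrefix (u ++ [a]) -
      (-1 : ℤ) ^ (u.length + 1) • (wordPrefix (u ++ [a]) ∘ₗ wordBoundary))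
    (fun v hv => wordBoundary_prefix_single_sub_mem a _ v _ (by simp) (by simpa using hv)) hy

lemma wordBoundary_mem_injectiveWords {S : Finset α} {l : ℕ} {z : List α →₀ ℤ}
    (hz : z ∈ injectiveWords S (l + 1)) : wordBoundary z ∈ injectiveWords S l := by
  refine map_supported_le _ (fun w hw => ?_) hz
  rw [wordBoundary_single, one_smul]
  -- The alphabet varies so that the induction can exclude the first letter `b` from the tail;
  -- prefixing `b` again then keeps words injective.
  suffices H : ∀ w : List α, ∀ T : Set α, w.Nodup → (∀ x ∈ w, x ∈ T) → wordBoundarySingle w ∈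
      Finsupp.supported ℤ ℤ {v : List α | v.Nodup ∧ (∀ x ∈ v, x ∈ T) ∧ v.length + 1 = w.length} by
    refine Finsupp.supported_mono ?_ (H w S hw.1 hw.2.1)
    rintro v ⟨h1, h2, h3⟩
    exact ⟨h1, h2, by have := hw.2.2; omega⟩
  intro w
  induction w with
  | nil => intros; simp [wordBoundarySingle]
  | cons b w ih =>
    intro T hw hT
    rw [List.nodup_cons] at hw
    refine Submodule.sub_mem _ (Finsupp.single_mem_supported ℤ _
      ⟨hw.2, fun x hx => hT x (by simp [hx]), by simp⟩) ?_
    refine map_supported_le _ (fun v hv => ?_) (ih (T ∩ {x | x ≠ b}) hw.2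
      fun x hx => ⟨hT x (by simp [hx]), fun h => hw.1 (h ▸ hx)⟩)
    rw [wordPrefix_single]
    refine Finsupp.single_mem_supported ℤ _ ⟨?_, ?_, ?_⟩
    · simp only [List.singleton_append, List.nodup_cons]
      exact ⟨fun hb => (hv.2.1 b hb).2 rfl, hv.1⟩
    · intro x hx
      rcases List.mem_cons.1 hx with rfl | hx
      · exact hT _ (by simp)
      · exact (hv.2.1 x hx).1
    · simp [hv.2.2]

/-- A word of `z` with `a` at or after position `s` has it exactly there, so it is counted once in
the sum, by its first `s` letters. Removing these words lowers the bound on the position of `a`. -/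
lemma sub_sum_prefix_strip_mem [DecidableEq α] {a : α} {s : ℕ} {z : List α →₀ ℤ}
    (hz : z ∈ wordsAvoidingFrom a (s + 1)) :
    z - ∑ u ∈ (z.support.image (List.take s)).filter (fun u => u.length = s),
      wordPrefix (u ++ [a]) (wordStrip (u ++ [a]) z) ∈ wordsAvoidingFrom a s := by
  have key : ∀ p w : List α, wordPrefix p (wordStrip p z) w = if p <+: w then z w else 0 := by
    intro p w
    split_ifs with h
    · obtain ⟨v, rfl⟩ := h
      rw [wordPrefix_apply_append, wordStrip_apply]
    · exact wordPrefix_apply_of_not_prefix h _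
  rw [wordsAvoidingFrom, Finsupp.mem_supported']
  intro w hw
  replace hw : a ∈ w.drop s := by simpa using hw
  rw [Finsupp.sub_apply, Finsupp.finsetSum_apply]
  simp only [key]
  by_cases hzw : z w = 0
  · simp [hzw]
  have hzs : a ∉ w.drop (s + 1) := by
    by_contra hc
    exact hzw ((Finsupp.mem_supported' ℤ z).1 hz w (by simpa using hc))
  have hlt : s < w.length := by
    by_contra hc
    simp [List.drop_eq_nil_of_le (not_lt.1 hc)] at hw
  have hdrop : w.drop s = a :: w.drop (s + 1) := by
    rw [List.drop_eq_getElem_cons hlt] at hw ⊢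
    rcases List.mem_cons.1 hw with h | h
    · rw [← h]
    · exact absurd h hzs
  have hw' : w = w.take s ++ [a] ++ w.drop (s + 1) := by
    conv_lhs => rw [← List.take_append_drop s w, hdrop]
    simp
  rw [Finset.sum_eq_single (w.take s)]
  · rw [if_pos ⟨_, hw'.symm⟩, sub_self]
  · intro u hu hne
    rw [if_neg]
    rintro ⟨v, hv⟩
    apply hne
    rw [← hv]
    have : u.length = s := (Finset.mem_filter.1 hu).2
    simp [← this]
  · intro h
    exact absurd (Finset.mem_filter.2 ⟨Finset.mem_image_of_mem _ (Finsupp.mem_support_iff.2 hzw),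
      by simp [hlt.le]⟩) h

/-- The complex of injective words in an alphabet `S` is exact in lengths below `|S|`. -/
theorem injectiveWords_exact (S : Finset α) {l : ℕ} (hl : l + 1 ≤ S.card) {z : List α →₀ ℤ}
    (hz : z ∈ injectiveWords S l) (hdz : wordBoundary z = 0) :
    ∃ y ∈ injectiveWords S (l + 1), wordBoundary y = z := by
  classical
  induction hn : S.card using Nat.strong_induction_on generalizing S l z with
  | _ n ih =>
  obtain ⟨a, haS⟩ : S.Nonempty := Finset.card_pos.1 (by omega)
  -- Inner induction: `z` is changed by boundaries until `a` is pushed out of all its words.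
  -- Initially `s = l` is a valid bound.
  suffices H : ∀ s : ℕ, ∀ z ∈ injectiveWords S l, z ∈ wordsAvoidingFrom a s → wordBoundary z = 0 →
      ∃ y ∈ injectiveWords S (l + 1), wordBoundary y = z by
    refine H l z hz (Finsupp.supported_mono ?_ hz) hdz
    rintro w ⟨-, -, rfl⟩
    simp
  intro s
  induction s with
  | zero =>
    intro z hz haz hdz
    refine ⟨wordPrefix [a] z, map_supported_le (s := {w | w ∈ {w : List α | w.Nodup ∧
      (∀ x ∈ w, x ∈ S) ∧ w.length = l} ∧ a ∉ w}) _ (fun w hw => ?_) ?_, ?_⟩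
    · rw [wordPrefix_single]
      refine Finsupp.single_mem_supported ℤ _ ⟨?_, ?_, ?_⟩
      · simpa using ⟨hw.2, hw.1.1⟩
      · intro x hx
        rcases List.mem_cons.1 hx with rfl | hx
        · exact haS
        · exact hw.1.2.1 x hx
      · simp [hw.1.2.2]
    · exact fun w hw => ⟨hz hw, by simpa using haz hw⟩
    · rw [wordBoundary_prefix_singleton, hdz, map_zero, sub_zero]
  | succ s ihs =>
    intro z hz haz hdz
    -- The coefficient of the prefix `u ++ [a]` is a cycle in the smaller alphabet without these
    -- letters, so the outer induction fills it. Lengths of word and alphabet both drop by `s + 1`.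
    have hex : ∀ u : List α, ∃ y : List α →₀ ℤ, u.length = s →
        wordBoundary y = wordStrip (u ++ [a]) z ∧ y ∈ wordsAvoidingFrom a 0 ∧
          wordPrefix (u ++ [a]) y ∈ injectiveWords S (l + 1) := by
      intro u
      by_cases hu : u.length = s
      swap
      · exact ⟨0, fun h => absurd h hu⟩
      by_cases h0 : wordStrip (u ++ [a]) z = 0
      · exact ⟨0, fun _ => ⟨by simp [h0], by simp, by simp⟩⟩
      obtain ⟨v, hv⟩ : ∃ v, wordStrip (u ++ [a]) z v ≠ 0 := by
        by_contra! hc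
        exact h0 (Finsupp.ext hc)
      rw [wordStrip_apply] at hv
      obtain ⟨hnd, hsub, hlen⟩ := hz (Finsupp.mem_support_iff.2 hv)
      have hpn : (u ++ [a]).Nodup := (List.nodup_append.1 hnd).1
      have hpS : (u ++ [a]).toFinset ⊆ S := fun x hx =>
        hsub x (List.mem_append_left _ (List.mem_toFinset.1 hx))
      have hcard : (S \ (u ++ [a]).toFinset).card = n - (s + 1) := by
        rw [Finset.card_sdiff_of_subset hpS, List.toFinset_card_of_nodup hpn, hn]
        simp [hu]
      have hlen' : v.length + (s + 1) = l := by
        rw [← hlen]; simp [hu]; omega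
      obtain ⟨y, hy, hdy⟩ := ih (n - (s + 1)) (by omega) (S \ (u ++ [a]).toFinset) (l := v.length)
        (z := wordStrip (u ++ [a]) z) (by omega) (by
          intro w hw
          have hzw : wordStrip (u ++ [a]) z w ≠ 0 := Finsupp.mem_support_iff.1 (Finset.mem_coe.1 hw)
          obtain ⟨h1, h2, h3⟩ := hz (Finsupp.mem_support_iff.2 hzw)
          have h1' := List.nodup_append.1 h1
          refine ⟨h1'.2.1, fun x hx => ?_, ?_⟩
          · refine Finset.mem_sdiff.2 ⟨h2 x (List.mem_append_right _ hx), fun hxp => ?_⟩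
            exact h1'.2.2 x (List.mem_toFinset.1 hxp) x hx rfl
          · rw [← hlen] at h3
            simpa using h3) (by
          have := wordStrip_boundary (u := u) (hu.symm ▸ haz)
          rw [hdz, map_zero] at this
          rcases neg_one_pow_eq_or ℤ (u.length + 1) with h | h <;> simpa [h] using this.symm) hcard
      refine ⟨y, fun _ => ⟨hdy, ?_, ?_⟩⟩
      · refine Finsupp.supported_mono ?_ hy
        rintro w ⟨-, hw, -⟩
        simp only [List.drop_zero, Set.mem_ofPred_eq]
        exact fun haw => (Finset.mem_sdiff.1 (hw a haw)).2 (by simp)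
      · refine map_supported_le _ (fun w hw => ?_) hy
        rw [wordPrefix_single]
        refine Finsupp.single_mem_supported ℤ _ ⟨?_, ?_, ?_⟩
        · refine List.nodup_append.2 ⟨hpn, hw.1, ?_⟩
          rintro x hx _ hy rfl
          exact (Finset.mem_sdiff.1 (hw.2.1 x hy)).2 (List.mem_toFinset.2 hx)
        · intro x hx
          rcases List.mem_append.1 hx with hx | hx
          · exact hpS (List.mem_toFinset.2 hx)
          · exact (Finset.mem_sdiff.1 (hw.2.1 x hx)).1
        · have := hw.2.2
          simp [hu]; omega
    choose y hy using hex
    set U := (z.support.image (List.take s)).filter (fun u => u.length = s) with hU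
    set Y := (-1 : ℤ) ^ (s + 1) • ∑ u ∈ U, wordPrefix (u ++ [a]) (y u) with hY
    have hUs : ∀ u ∈ U, u.length = s := fun u hu => (Finset.mem_filter.1 hu).2
    have hYmem : Y ∈ injectiveWords S (l + 1) :=
      Submodule.smul_mem _ _ (Submodule.sum_mem _ fun u hu => (hy u (hUs u hu)).2.2)
    have hsign : (-1 : ℤ) ^ (s + 1) * (-1 : ℤ) ^ (s + 1) = 1 := by
      rw [← mul_pow]; simp
    -- Up to words avoiding `a` from `s` on, the boundary of `Y` is the part of `z` with `a` at
    -- position `s`; the sign in `Y` cancels that of passing the prefix.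
    have hrest : z - wordBoundary Y ∈ wordsAvoidingFrom a s := by
      have h1 := sub_sum_prefix_strip_mem haz
      have h2 : (-1 : ℤ) ^ (s + 1) • ∑ u ∈ U, (wordBoundary (wordPrefix (u ++ [a]) (y u)) -
          (-1 : ℤ) ^ (s + 1) • wordPrefix (u ++ [a]) (wordBoundary (y u))) ∈
            wordsAvoidingFrom a s := by
        refine Submodule.smul_mem _ _ (Submodule.sum_mem _ fun u hu => ?_)
        have := wordBoundary_prefix_sub_mem (u := u) (hy u (hUs u hu)).2.1
        rwa [hUs u hu] at this
      have e : ∑ u ∈ U, wordPrefix (u ++ [a]) (wordBoundary (y u)) =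
          ∑ u ∈ U, wordPrefix (u ++ [a]) (wordStrip (u ++ [a]) z) :=
        Finset.sum_congr rfl fun u hu => by rw [(hy u (hUs u hu)).1]
      rw [Finset.sum_sub_distrib, smul_sub, ← Finset.smul_sum, smul_smul, hsign, one_smul, e] at h2
      have h3 := Submodule.sub_mem _ h1 h2
      rw [hY, map_smul, map_sum]
      rwa [sub_sub_sub_cancel_right] at h3
    have hdd := wordBoundary_wordBoundary Y
    obtain ⟨y', hy', hdy'⟩ := ihs (z - wordBoundary Y)
      (Submodule.sub_mem _ hz (wordBoundary_mem_injectiveWords hYmem)) hrest (by simp [hdz, hdd])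
    exact ⟨y' + Y, Submodule.add_mem _ hy' hYmem, by simp [hdy']⟩

end Words

/-! ### The trace homotopy and the representations `k[X] ⊗ M`. -/

section Acyclic

universe u

variable {k G : Type u} [CommRing k] [Group G]

lemma Fin.contractNth_succ_cons {α : Type*} (op : α → α → α) {n : ℕ} (j : Fin (n + 1)) (y : α)
    (g : Fin (n + 1) → α) :
    Fin.contractNth j.succ op (Fin.cons y g) = Fin.cons y (Fin.contractNth j op g) := by
  funext i
  refine Fin.cases ?_ (fun i => ?_) i
  · rw [Fin.contractNth_apply_of_lt _ _ _ _ (by simp)]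
    rfl
  · rcases lt_trichotomy (i : ℕ) j with h | h | h
    · rw [Fin.contractNth_apply_of_lt _ _ _ _ (by simpa using h), Fin.cons_succ,
        Fin.contractNth_apply_of_lt _ _ _ _ h, ← Fin.succ_castSucc, Fin.cons_succ]
    · rw [Fin.contractNth_apply_of_eq _ _ _ _ (by simpa using h), Fin.cons_succ,
        Fin.cons_succ, Fin.contractNth_apply_of_eq _ _ _ _ h, ← Fin.succ_castSucc, Fin.cons_succ]
    · rw [Fin.contractNth_apply_of_gt _ _ _ _ (by simpa using h), Fin.cons_succ,
        Fin.cons_succ, Fin.contractNth_apply_of_gt _ _ _ _ h]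

lemma Fin.contractNth_zero_cons {α : Type*} (op : α → α → α) {n : ℕ} (y : α)
    (g : Fin (n + 1) → α) :
    Fin.contractNth 0 op (Fin.cons y g) = Fin.cons (op y (g 0)) (fun i => g i.succ) := by
  funext i
  refine Fin.cases ?_ (fun i => ?_) i
  · rw [Fin.contractNth_apply_of_eq _ _ _ _ (by simp)]
    rfl
  · rw [Fin.contractNth_apply_of_gt _ _ _ _ (by simp)]
    rfl

namespace groupHomology

open Finsupp

/-- The homotopy on inhomogeneous chains attached to a linear endomorphism `e`. -/
noncomputable def traceHomotopy [Fintype G] (A : Rep.{u} k G) (e : A →ₗ[k] A) (n : ℕ) :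
    ((Fin n → G) →₀ A) →ₗ[k] ((Fin (n + 1) → G) →₀ A) :=
  lsum k fun g => ∑ x : G,
    lsingle (Fin.cons x⁻¹ g : Fin (n + 1) → G) ∘ₗ e ∘ₗ A.ρ x⁻¹

lemma traceHomotopy_single [Fintype G] (A : Rep.{u} k G) (e : A →ₗ[k] A) (n : ℕ)
    (g : Fin n → G) (a : A) :
    traceHomotopy A e n (single g a) =
      ∑ x : G, single (Fin.cons x⁻¹ g : Fin (n + 1) → G) (e (A.ρ x⁻¹ a)) := by
  simp [traceHomotopy]

/-- The leading face of the homotopy sums to the trace of `e`, which is the identity. All other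
faces cancel against the homotopy of the boundary. -/
lemma d_traceHomotopy_add [Fintype G] (A : Rep.{u} k G) (e : A →ₗ[k] A)
    (he : ∀ a, ∑ g : G, A.ρ g (e (A.ρ g⁻¹ a)) = a) (n : ℕ) (c : (Fin (n + 1) → G) →₀ A) :
    inhomogeneousChains.d A (n + 1) (traceHomotopy A e (n + 1) c) +
      traceHomotopy A e n (inhomogeneousChains.d A n c) = c := by
  induction c using Finsupp.induction_linear with
  | zero => simp
  | add x y hx hy =>
    simp only [map_add]
    rw [add_add_add_comm, hx, hy]
  | single g a =>
    have h0 : ∑ x : G, single (Fin.cons (x⁻¹ * g 0) (fun i : Fin n => g i.succ) : Fin (n + 1) → G)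
          (e (A.ρ x⁻¹ a)) =
        ∑ x : G, single (Fin.cons x⁻¹ (fun i : Fin n => g i.succ) : Fin (n + 1) → G)
          (e (A.ρ x⁻¹ (A.ρ (g 0)⁻¹ a))) := by
      -- Translating `x` by `(g 0)⁻¹` identifies the face merging `x⁻¹` with `g 0` with the homotopy
      -- of the leading face of `g`.
      refine Fintype.sum_equiv (Equiv.mulLeft (g 0)⁻¹) _ _ fun x => ?_
      have : A.ρ x⁻¹ a = A.ρ ((g 0)⁻¹ * x)⁻¹ (A.ρ (g 0)⁻¹ a) := by
        rw [← Module.End.mul_apply, ← map_mul]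
        simp [mul_assoc]
      rw [this]
      simp
    have h1 : ∑ x : G, single g (A.ρ x (e (A.ρ x⁻¹ a))) = single g a := by
      rw [← single_finsetSum, he]
    rw [traceHomotopy_single, map_sum]
    simp only [inhomogeneousChains.d_single (k := k), Fin.cons_zero, Fin.cons_succ, inv_inv]
    rw [Finset.sum_add_distrib, h1, map_add, traceHomotopy_single, map_sum, add_assoc]
    simp only [map_smul, traceHomotopy_single]
    rw [Finset.sum_comm (s := Finset.univ) (t := Finset.univ)]
    rw [Fin.sum_univ_succ]
    simp only [Fin.contractNth_zero_cons, Fin.contractNth_succ_cons, ← Finset.smul_sum, h0]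
    simp only [Fin.val_zero, Fin.val_succ, pow_succ, mul_neg, mul_one, neg_smul, pow_zero,
      one_smul, neg_neg, Finset.sum_neg_distrib]
    abel

theorem isZero_of_trace_eq_id [Fintype G] (A : Rep.{u} k G) (e : A →ₗ[k] A)
    (he : ∀ a, ∑ g : G, A.ρ g (e (A.ρ g⁻¹ a)) = a) (n : ℕ) :
    Limits.IsZero (groupHomology A (n + 1)) := by
  apply HomologicalComplex.ExactAt.isZero_homology
  rw [HomologicalComplex.exactAt_iff' _ (n + 2) (n + 1) n (by simp) (by simp),
    ShortComplex.moduleCat_exact_iff]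
  intro c hc
  refine ⟨traceHomotopy A e (n + 1) c, ?_⟩
  have h := d_traceHomotopy_add A e he n c
  have hc' : inhomogeneousChains.d A n c = 0 := by
    rw [← inhomogeneousChains.d_def]; exact hc
  rw [hc', map_zero, add_zero, ← inhomogeneousChains.d_def] at h
  exact h

end groupHomology

namespace Rep

open Finsupp

lemma exact_of_forall_exists {S : ShortComplex (Rep.{u} k G)}
    (h : ∀ x : S.X₂, S.g.hom x = 0 → ∃ y : S.X₁, S.f.hom y = x) : S.Exact :=
  (forget₂ (Rep.{u} k G) (ModuleCat k)).reflects_exact_of_faithful _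
    ((ShortComplex.moduleCat_exact_iff _).2 h)

/-- The action of `G` on finitely supported functions on a `G`-set `X` with values in `M`. -/
noncomputable def permutedRepresentation (X : Type u) [MulAction G X] (M : Rep.{u} k G) :
    Representation k G (X →₀ M) where
  toFun g := lmapDomain M k (g • ·) ∘ₗ mapRange.linearMap (M.ρ g)
  map_one' := by
    ext; simp
  map_mul' g h := by
    ext x m y; simp [mul_smul]

@[simp] lemma permutedRepresentation_single {X : Type u} [MulAction G X] (M : Rep.{u} k G) (g : G)
    (x : X) (m : M) :
    permutedRepresentation X M g (single x m) = single (g • x) (M.ρ g m) := by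
  change (lmapDomain M k (g • ·) ∘ₗ mapRange.linearMap (M.ρ g)) (single x m) = _
  simp

/-- The representation `k[X] ⊗ M`: finitely supported functions on a `G`-set `X` with values
in `M`. -/
noncomputable abbrev permuted (X : Type u) [MulAction G X] (M : Rep.{u} k G) : Rep.{u} k G :=
  Rep.of (permutedRepresentation X M)

variable (X : Type u) [MulAction G X]

/-- `permuted` as a functor. -/
noncomputable def permutedMap {M N : Rep.{u} k G} (f : M ⟶ N) : permuted X M ⟶ permuted X N :=
  Rep.ofHom (σ := (permuted X N).ρ) (ρ := (permuted X M).ρ)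
    ⟨mapRange.linearMap f.hom.toLinearMap, fun g => by
      apply lhom_ext
      intro x m
      have := Rep.hom_comm_apply f g m
      simpa using congrArg (single (g • x)) this⟩

/-- The morphism of representations induced by an equivariant map of `G`-sets. -/
noncomputable def permutedMapDomain {X Y : Type u} [MulAction G X] [MulAction G Y] (φ : X → Y)
    (hφ : ∀ (g : G) x, φ (g • x) = g • φ x) (M : Rep.{u} k G) : permuted X M ⟶ permuted Y M :=
  Rep.ofHom (σ := permutedRepresentation Y M) (ρ := permutedRepresentation X M)
    ⟨lmapDomain M k φ, fun g => by
      apply lhom_ext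
      intro x m
      simp [hφ]⟩

lemma permutedMapDomain_single {X Y : Type u} [MulAction G X] [MulAction G Y] (φ : X → Y)
    (hφ : ∀ (g : G) x, φ (g • x) = g • φ x) (M : Rep.{u} k G) (x : X) (m : M) :
    (permutedMapDomain φ hφ M).hom (single x m) = single (φ x) m :=
  mapDomain_single

/-- The inclusion of `M` as the summand of `k[X] ⊗ M` at a point fixed by `f`. -/
noncomputable def toPermuted {H : Type u} [Group H] (f : H →* G) (x : X) (hx : ∀ h, f h • x = x)
    (M : Rep.{u} k G) : res f M ⟶ res f (permuted X M) :=
  Rep.ofHom (σ := (res f (permuted X M)).ρ) (ρ := (res f M).ρ)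
    ⟨lsingle x, fun h => by
      ext m
      simp [hx]⟩

end Rep

end Acyclic

/-! ### Relatively projective representations and dimension shifting. -/

section Acyclic

universe u

variable {k G : Type u} [CommRing k] [Group G]

namespace Rep

open Finsupp

/-- A representation of a finite group whose identity is the trace of a linear endomorphism. -/
def IsRelativelyProjective [Fintype G] (A : Rep.{u} k G) : Prop :=
  ∃ e : A →ₗ[k] A, ∀ a, ∑ g : G, A.ρ g (e (A.ρ g⁻¹ a)) = a

lemma IsRelativelyProjective.isZero_groupHomology [Fintype G] {A : Rep.{u} k G}
    (h : A.IsRelativelyProjective) (n : ℕ) : Limits.IsZero (groupHomology A (n + 1)) := by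
  obtain ⟨e, he⟩ := h
  exact groupHomology.isZero_of_trace_eq_id A e he n

lemma exists_transversal {H : Type u} [Group H] {f : H →* G} (hf : Function.Injective f) :
    ∃ T : Set G, ∀ x : G, ∃! h : H, (f h)⁻¹ * x ∈ T := by
  let r : Setoid G :=
    { r := fun x y => ∃ h, f h * x = y
      iseqv := ⟨fun x => ⟨1, by simp⟩, fun {x y} ⟨h, e⟩ => ⟨h⁻¹, by simp [← e]⟩,
        fun {x y z} ⟨h, e⟩ ⟨h', e'⟩ => ⟨h' * h, by simp [← e', ← e, mul_assoc]⟩⟩ }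
  refine ⟨Set.range (Quotient.out (s := r)), fun x => ?_⟩
  obtain ⟨h, hh⟩ : ∃ h, f h * (Quotient.mk r x).out = x := Quotient.mk_out (s := r) x
  refine ⟨h, ⟨Quotient.mk r x, ?_⟩, ?_⟩
  · rw [eq_inv_mul_iff_mul_eq, hh]
  · rintro h' ⟨c, hc⟩
    have hx : f h' * c.out = x := by rw [hc]; simp
    have hcx : c = Quotient.mk r x := by
      rw [← Quotient.out_eq c]
      exact Quotient.sound ⟨h', hx⟩
    subst hcx
    exact hf (mul_right_cancel (hx.trans hh.symm))

/-- The endomorphism is the projection onto the summands indexed by a transversal `T` of the cosets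
of `f(H)`. The translates of `T` partition `G`, so its conjugates sum to the identity. -/
lemma isRelativelyProjective_res_permuted {H : Type u} [Group H] [Fintype H] {f : H →* G}
    (hf : Function.Injective f) (M : Rep.{u} k G) :
    (res f (permuted G M)).IsRelativelyProjective := by
  classical
  obtain ⟨T, hT⟩ := exists_transversal hf
  let e : (G →₀ M) →ₗ[k] (G →₀ M) := lsum k fun x => if x ∈ T then lsingle x else 0
  have he : ∀ x (m : M), e (single x m) = if x ∈ T then single x m else 0 := by
    intro x m
    simp only [e, lsum_single]
    split_ifs <;> rfl
  refine ⟨e, fun a => ?_⟩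
  change ∑ h : H, permutedRepresentation G M (f h) (e (permutedRepresentation G M (f h⁻¹) a)) = a
  induction a using Finsupp.induction_linear with
  | zero => simp
  | add x y hx hy => simp only [map_add, Finset.sum_add_distrib]; rw [hx, hy]
  | single x m =>
    obtain ⟨h, hh, huniq⟩ := hT x
    rw [Finset.sum_eq_single h]
    · rw [permutedRepresentation_single, he, if_pos (by simpa using hh),
        permutedRepresentation_single]
      simp
    · intro h' _ hne
      rw [permutedRepresentation_single, he, if_neg fun hc => hne (huniq h' (by simpa using hc)),
        map_zero]
    · simp

lemma IsRelativelyProjective.permuted [Fintype G] {A : Rep.{u} k G} (h : A.IsRelativelyProjective)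
    (X : Type u) [MulAction G X] : (Rep.permuted X A).IsRelativelyProjective := by
  obtain ⟨e, he⟩ := h
  refine ⟨mapRange.linearMap e, fun a => ?_⟩
  change ∑ g : G, permutedRepresentation X A g
    (mapRange.linearMap e (permutedRepresentation X A g⁻¹ a)) = a
  induction a using Finsupp.induction_linear with
  | zero => simp
  | add x y hx hy => simp only [map_add, Finset.sum_add_distrib]; rw [hx, hy]
  | single x m =>
    simp only [permutedRepresentation_single, mapRange.linearMap_apply, mapRange_single,
      smul_inv_smul, ← single_finsetSum, he]

lemma isRelativelyProjective_permuted [Fintype G] (M : Rep.{u} k G) :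
    (permuted G M).IsRelativelyProjective :=
  isRelativelyProjective_res_permuted (f := MonoidHom.id G) Function.injective_id M

/-- The counit `k[G] ⊗ M ⟶ M`. -/
noncomputable def permutedCounit (M : Rep.{u} k G) : permuted G M ⟶ M :=
  Rep.ofHom (σ := M.ρ) (ρ := permutedRepresentation G M)
    ⟨lsum k fun _ => LinearMap.id, fun g => by
      apply lhom_ext
      intro x m
      simp⟩

instance (M : Rep.{u} k G) : Epi (permutedCounit M) := by
  rw [epi_iff_surjective]
  intro m
  refine ⟨single 1 m, ?_⟩
  change (lsum k fun _ : G => (LinearMap.id : M →ₗ[k] M)) (single 1 m) = m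
  simp

/-- Dimension shifting: `M` as a quotient of a relatively projective representation. -/
noncomputable def shiftComplex (M : Rep.{u} k G) : ShortComplex (Rep.{u} k G) :=
  ShortComplex.mk (Limits.kernel.ι (permutedCounit M)) (permutedCounit M)
    (Limits.kernel.condition _)

lemma shiftComplex_shortExact (M : Rep.{u} k G) : (shiftComplex M).ShortExact where
  exact := ShortComplex.exact_of_f_is_kernel _ (Limits.kernelIsKernel _)
  mono_f := Limits.equalizer.ι_mono
  epi_g := inferInstanceAs (Epi (permutedCounit M))

/-- `permuted X` as an endofunctor. -/
noncomputable def permutedFunctor (X : Type u) [MulAction G X] : Rep.{u} k G ⥤ Rep.{u} k G where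
  obj M := permuted X M
  map f := permutedMap X f
  map_id M := by
    ext : 2
    exact mapRange.linearMap_id
  map_comp f g := by
    ext : 2
    exact mapRange.linearMap_comp (α := X) g.hom.toLinearMap f.hom.toLinearMap

instance (X : Type u) [MulAction G X] : (permutedFunctor (k := k) (G := G) X).PreservesZeroMorphisms where
  map_zero M N := by
    apply Rep.hom_ext
    apply Representation.IntertwiningMap.ext
    change mapRange.linearMap (0 : M →ₗ[k] N) = 0
    ext; simp

lemma permutedFunctor_shortExact (X : Type u) [MulAction G X] {S : ShortComplex (Rep.{u} k G)}
    (hS : S.ShortExact) : (S.map (permutedFunctor X)).ShortExact := by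
  have hm := hS.mono_f
  have he := hS.epi_g
  refine { exact := ?_, mono_f := ?_, epi_g := ?_ }
  · rw [← ShortComplex.exact_map_iff_of_faithful _ (forget₂ (Rep.{u} k G) (ModuleCat k)),
      ShortComplex.moduleCat_exact_iff_range_eq_ker]
    have : LinearMap.range S.f.hom.toLinearMap = LinearMap.ker S.g.hom.toLinearMap :=
      (hS.exact.map (forget₂ (Rep k G) (ModuleCat k))).moduleCat_range_eq_ker
    change LinearMap.range (mapRange.linearMap (α := X) S.f.hom.toLinearMap) =
      LinearMap.ker (mapRange.linearMap (α := X) S.g.hom.toLinearMap)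
    rw [ker_mapRange, range_mapRange_linearMap S.f.hom.toLinearMap (LinearMap.ker_eq_bot.2 <|
        (Rep.mono_iff_injective S.f).1 hS.mono_f), this]
  · rw [mono_iff_injective]
    exact mapRange_injective _ (map_zero _) ((Rep.mono_iff_injective _).1 hm)
  · rw [epi_iff_surjective]
    exact mapRange_surjective _ (map_zero _) ((Rep.epi_iff_surjective _).1 he)

end Rep

/-! ### Inner automorphisms and Shapiro's lemma. -/

namespace groupHomology

lemma H0π_ρ (A : Rep.{u} k G) (g : G) (a : A) : H0π A (A.ρ g a) = H0π A a := by
  have h := congrArg (H0Iso A).inv.hom (Representation.Coinvariants.mk_self_apply A.ρ g a)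
  have e : ∀ a : A, (H0Iso A).inv.hom (Representation.Coinvariants.mk A.ρ a) = H0π A a :=
    fun a => ConcreteCategory.congr_hom (coinvariantsMk_comp_H0Iso_inv A) a
  rwa [e, e] at h

lemma H0π_surjective (A : Rep.{u} k G) : Function.Surjective (H0π A) :=
  (ModuleCat.epi_iff_surjective _).1 inferInstance

lemma exists_H0_desc (A : Rep.{u} k G) {N : Type u} [AddCommGroup N] [Module k N]
    (φ : A →ₗ[k] N) (h : ∀ g a, φ (A.ρ g a) = φ a) :
    ∃ ψ : groupHomology A 0 →ₗ[k] N, ∀ a, ψ (H0π A a) = φ a := by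
  refine ⟨(Representation.Coinvariants.lift A.ρ φ fun g => LinearMap.ext (h g)) ∘ₗ
    (H0Iso A).hom.hom, fun a => ?_⟩
  have e : (H0Iso A).hom.hom (H0π A a) = Representation.Coinvariants.mk A.ρ a :=
    ConcreteCategory.congr_hom (H0π_comp_H0Iso_hom A) a
  simp [e]

/-- The coefficient map of the conjugation action of `g`. -/
noncomputable def conjHom (g : G) (A : Rep.{u} k G) :
    A ⟶ Rep.res (MulAut.conj g).toMonoidHom A :=
  Rep.ofHom (ρ := A.ρ) (σ := (Rep.res (MulAut.conj g).toMonoidHom A).ρ)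
    ⟨A.ρ g, fun h => by
      ext a
      simp [← Module.End.mul_apply, ← map_mul]⟩

lemma chainsMap_conj_naturality (g : G) {A B : Rep.{u} k G} (f : A ⟶ B) :
    chainsMap (MulAut.conj g).toMonoidHom (conjHom g A) ≫ chainsMap (MonoidHom.id G) f =
      chainsMap (MonoidHom.id G) f ≫ chainsMap (MulAut.conj g).toMonoidHom (conjHom g B) := by
  rw [← chainsMap_comp, ← chainsMap_comp]
  refine chainsMap_congr rfl ?_
  ext a
  exact Rep.hom_comm_apply f g a

/-- The conjugation action of `g` on the chains of a short complex. -/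
noncomputable def conjShortComplexMap (g : G) (S : ShortComplex (Rep.{u} k G)) :
    S.map (chainsFunctor k G) ⟶ S.map (chainsFunctor k G) where
  τ₁ := chainsMap (MulAut.conj g).toMonoidHom (conjHom g S.X₁)
  τ₂ := chainsMap (MulAut.conj g).toMonoidHom (conjHom g S.X₂)
  τ₃ := chainsMap (MulAut.conj g).toMonoidHom (conjHom g S.X₃)
  comm₁₂ := chainsMap_conj_naturality g S.f
  comm₂₃ := chainsMap_conj_naturality g S.g

/-- Inner automorphisms act trivially on group homology. -/
theorem map_conj [Finite G] (g : G) (A : Rep.{u} k G) (n : ℕ) :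
    map (MulAut.conj g).toMonoidHom (conjHom g A) n = 𝟙 _ := by
  have := Fintype.ofFinite G
  induction n generalizing A with
  | zero =>
    rw [← cancel_epi (H0π A), H0π_comp_map, Category.comp_id]
    ext a
    exact H0π_ρ A g a
  | succ n ih =>
    -- The connecting map into degree `n` is injective, because the middle term is acyclic, and
    -- commutes with conjugation.
    have hS := Rep.shiftComplex_shortExact A
    have hmono := mono_δ_of_isZero hS n
      ((Rep.isRelativelyProjective_permuted A).isZero_groupHomology n)
    refine (cancel_mono (δ hS (n + 1) n rfl)).1 ?_
    have h := HomologicalComplex.HomologySequence.δ_naturality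
      (conjShortComplexMap g (Rep.shiftComplex A)) (map_chainsFunctor_shortExact hS)
      (map_chainsFunctor_shortExact hS) (n + 1) n rfl
    refine h.symm.trans ?_
    have e : HomologicalComplex.homologyMap (conjShortComplexMap g (Rep.shiftComplex A)).τ₁ n =
      𝟙 _ := ih _
    rw [e, Category.comp_id]
    exact (Category.id_comp _).symm

section Shapiro

variable {H : Type u} [Group H] (f : H →* G) (X : Type u) [MulAction G X] (x : X)
  (hx : ∀ h, f h • x = x)

lemma chainsMap_toPermuted_naturality {A B : Rep.{u} k G} (φ : A ⟶ B) :
    chainsMap f (Rep.toPermuted X f x hx A) ≫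
        chainsMap (MonoidHom.id G) (Rep.permutedMap X φ) =
      chainsMap (MonoidHom.id H) ((Rep.resFunctor f).map φ) ≫
        chainsMap f (Rep.toPermuted X f x hx B) := by
  rw [← chainsMap_comp, ← chainsMap_comp]
  refine chainsMap_congr rfl ?_
  refine LinearMap.ext fun a => ?_
  exact Finsupp.mapRange_single (f := φ.hom) (hf := map_zero _)

/-- The chain-level Shapiro map of a short complex. -/
noncomputable def shapiroShortComplexMap (S : ShortComplex (Rep.{u} k G)) :
    (S.map (Rep.resFunctor f)).map (chainsFunctor k H) ⟶
      (S.map (Rep.permutedFunctor X)).map (chainsFunctor k G) where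
  τ₁ := chainsMap f (Rep.toPermuted X f x hx S.X₁)
  τ₂ := chainsMap f (Rep.toPermuted X f x hx S.X₂)
  τ₃ := chainsMap f (Rep.toPermuted X f x hx S.X₃)
  comm₁₂ := chainsMap_toPermuted_naturality f X x hx S.f
  comm₂₃ := chainsMap_toPermuted_naturality f X x hx S.g

lemma map_toPermuted_zero_H0π (M : Rep.{u} k G) (m : M) :
    map f (Rep.toPermuted X f x hx M) 0 (H0π (Rep.res f M) m) =
      H0π (Rep.permuted X M) (Finsupp.single x m) :=
  ConcreteCategory.congr_hom (H0π_comp_map f (Rep.toPermuted X f x hx M)) m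

/-- On coinvariants the inverse sends `y ⊗ m` to `(σ y)⁻¹ m`, where `σ y` carries `x` to `y`. -/
lemma isIso_map_toPermuted_zero (htrans : ∀ y : X, ∃ g : G, g • x = y)
    (hstab : ∀ g : G, g • x = x → ∃ h, f h = g) (M : Rep.{u} k G) :
    IsIso (map f (Rep.toPermuted X f x hx M) 0) := by
  choose σ hσ using htrans
  rw [ConcreteCategory.isIso_iff_bijective]
  constructor
  · have hres : ∀ h m, H0π (Rep.res f M) (M.ρ (f h) m) = H0π (Rep.res f M) m :=
      fun h m => H0π_ρ (Rep.res f M) h m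
    obtain ⟨ψ, hψ⟩ := exists_H0_desc (Rep.permuted X M) (N := groupHomology (Rep.res f M) 0)
      (Finsupp.lsum k fun y => (H0π (Rep.res f M)).hom ∘ₗ M.ρ (σ y)⁻¹) (by
        intro g a
        change Finsupp.lsum k _ (Rep.permutedRepresentation X M g a) = _
        induction a using Finsupp.induction_linear with
        | zero => simp
        | add a b ha hb => simp only [map_add]; rw [ha, hb]
        | single y m =>
          -- The two values differ by an element of the stabilizer of `x`, which acts trivially on
          -- coinvariants over `H`.
          obtain ⟨h, hh⟩ := hstab ((σ (g • y))⁻¹ * g * σ y) (by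
            rw [mul_smul, mul_smul, hσ, inv_smul_eq_iff, hσ])
          rw [Rep.permutedRepresentation_single, Finsupp.lsum_single, Finsupp.lsum_single]
          change H0π (Rep.res f M) (M.ρ (σ (g • y))⁻¹ (M.ρ g m)) =
            H0π (Rep.res f M) (M.ρ (σ y)⁻¹ m)
          rw [← hres h (M.ρ (σ y)⁻¹ m), hh, ← Module.End.mul_apply, ← Module.End.mul_apply, ← map_mul, ← map_mul]
          simp)
    -- The chosen `σ x` need not be `1`, but it stabilizes `x`.
    obtain ⟨h₀, hh₀⟩ := hstab (σ x)⁻¹ (by rw [inv_smul_eq_iff, hσ])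
    have hleft : Function.LeftInverse ψ (map f (Rep.toPermuted X f x hx M) 0) := by
      intro z
      obtain ⟨m, rfl⟩ := H0π_surjective _ z
      rw [map_toPermuted_zero_H0π, hψ, Finsupp.lsum_single]
      change H0π (Rep.res f M) (M.ρ (σ x)⁻¹ m) = _
      rw [← hh₀, hres]
    exact hleft.injective
  · intro z
    obtain ⟨a, rfl⟩ := H0π_surjective _ z
    change ∃ z', map f (Rep.toPermuted X f x hx M) 0 z' = H0π (Rep.permuted X M) a
    induction a using Finsupp.induction_linear with
    | zero => exact ⟨0, by simp⟩
    | add a b ha hb =>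
      obtain ⟨a', ha'⟩ := ha
      obtain ⟨b', hb'⟩ := hb
      exact ⟨a' + b', by rw [map_add, ha', hb', map_add]⟩
    | single y m =>
      refine ⟨H0π (Rep.res f M) (M.ρ (σ y)⁻¹ m), ?_⟩
      rw [map_toPermuted_zero_H0π, ← H0π_ρ _ (σ y)]
      congr 1
      refine (Rep.permutedRepresentation_single M (σ y) x _).trans ?_
      rw [hσ, ← Module.End.mul_apply, ← map_mul]
      simp

/-- Shapiro's lemma, with the isomorphism given by the inclusion of the stabilizer. -/
theorem isIso_map_toPermuted [Finite G] (hf : Function.Injective f)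
    (htrans : ∀ y : X, ∃ g : G, g • x = y)
    (hstab : ∀ g : G, g • x = x → ∃ h, f h = g) (M : Rep.{u} k G) (n : ℕ) :
    IsIso (map f (Rep.toPermuted X f x hx M) n) := by
  have := Fintype.ofFinite G
  have := Finite.of_injective f hf
  have := Fintype.ofFinite H
  induction n generalizing M with
  | zero => exact isIso_map_toPermuted_zero f X x hx htrans hstab M
  | succ n ih =>
    -- Dimension shifting on both sides: the middle terms are acyclic over `H` and over `G`, and the
    -- four lemmas compare the ends.
    have hS := Rep.shiftComplex_shortExact M
    have hS₁ := map_chainsFunctor_shortExact ((Rep.shortExact_res f).2 hS)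
    have hS₂ := map_chainsFunctor_shortExact (Rep.permutedFunctor_shortExact X hS)
    have hz₁ : Limits.IsZero (groupHomology (Rep.res f (Rep.permuted G M)) (n + 1)) :=
      (Rep.isRelativelyProjective_res_permuted hf M).isZero_groupHomology n
    have hz₂ : Limits.IsZero (groupHomology (Rep.permuted X (Rep.permuted G M)) (n + 1)) :=
      ((Rep.isRelativelyProjective_permuted M).permuted X).isZero_groupHomology n
    have hmono : Mono (HomologicalComplex.homologyMap
        (shapiroShortComplexMap f X x hx (Rep.shiftComplex M)).τ₃ (n + 1)) := by
      have h₁ : Mono (hS₁.δ (n + 1) n rfl) := ShortComplex.SnakeInput.mono_δ _ hz₁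
      have h₂ : IsIso (HomologicalComplex.homologyMap
        (shapiroShortComplexMap f X x hx (Rep.shiftComplex M)).τ₁ n) := ih _
      have h := HomologicalComplex.HomologySequence.δ_naturality
        (shapiroShortComplexMap f X x hx (Rep.shiftComplex M)) hS₁ hS₂ (n + 1) n rfl
      exact mono_of_mono_fac h.symm
    have hepi : Epi (HomologicalComplex.homologyMap
        (shapiroShortComplexMap f X x hx (Rep.shiftComplex M)).τ₃ (n + 1)) := by
      refine HomologicalComplex.HomologySequence.epi_homologyMap_τ₃ _ hS₁ hS₂ (n + 1)
        ⟨fun _ _ _ => hz₂.eq_of_src _ _⟩ ?_ ?_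
      · intro j hj
        obtain rfl : j = n := by simpa using hj
        have : IsIso (HomologicalComplex.homologyMap
          (shapiroShortComplexMap f X x hx (Rep.shiftComplex M)).τ₁ j) := ih _
        infer_instance
      · intro j hj
        obtain rfl : j = n := by simpa using hj
        have : IsIso (HomologicalComplex.homologyMap
          (shapiroShortComplexMap f X x hx (Rep.shiftComplex M)).τ₂ j) := ih _
        infer_instance
    exact isIso_of_mono_of_epi (HomologicalComplex.homologyMap
      (shapiroShortComplexMap f X x hx (Rep.shiftComplex M)).τ₃ (n + 1))

end Shapiro

end groupHomology

end Acyclic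

/-! ### The stability argument for an exact complex of representations. -/

namespace groupHomology

open Limits

universe u

variable {k G : Type u} [CommRing k] [Group G]

lemma epi_functor_map_succ_of_mono {S : ShortComplex (Rep.{u} k G)} (hS : S.ShortExact) (q : ℕ)
    (h : Mono ((functor k G q).map S.f)) : Epi ((functor k G (q + 1)).map S.g) := by
  have hδ : δ hS (q + 1) q rfl = 0 := by
    have hw : δ hS (q + 1) q rfl ≫ (functor k G q).map S.f = 0 := (mapShortComplex₁ hS rfl).zero
    exact h.right_cancellation _ _ (hw.trans zero_comp.symm)
  exact (ShortComplex.exact_iff_epi _ hδ).1 (mapShortComplex₃_exact hS rfl)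

lemma chainsMap_id_add {A B : Rep.{u} k G} (f g : A ⟶ B) :
    chainsMap (MonoidHom.id G) (f + g) =
      chainsMap (MonoidHom.id G) f + chainsMap (MonoidHom.id G) g := by
  refine HomologicalComplex.hom_ext _ _ fun i => ModuleCat.hom_ext ?_
  refine Eq.trans ?_ (ModuleCat.hom_add _ _).symm
  rw [chainsMap_id_f_hom_eq_mapRange, chainsMap_id_f_hom_eq_mapRange,
    chainsMap_id_f_hom_eq_mapRange]
  refine Finsupp.lhom_ext fun x a => ?_
  simp [Rep.add_hom]

instance functor_additive (q : ℕ) : (functor k G q).Additive where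
  map_add {_ _ f g} :=
    (congrArg (fun φ => HomologicalComplex.homologyMap φ q) (chainsMap_id_add f g)).trans
      (HomologicalComplex.homologyMap_add _ _ _)

lemma mono_functor_map_of_eq_zero {S : ShortComplex (Rep.{u} k G)} (hS : S.ShortExact) (q : ℕ)
    (h : (functor k G q).map S.f = 0) : Mono ((functor k G q).map S.g) :=
  (ShortComplex.exact_iff_mono _ h).1 (mapShortComplex₂_exact hS q)

variable {C : ℕ → Rep.{u} k G} (d : ∀ l, C (l + 1) ⟶ C l) (hd : ∀ l, d (l + 1) ≫ d l = 0)

include hd in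
lemma comp_factorThruImage (l : ℕ) : d (l + 1) ≫ factorThruImage (d l) = 0 := by
  rw [← cancel_mono (image.ι (d l)), Category.assoc, image.fac, hd, zero_comp]

include hd in
lemma imageι_comp_factorThruImage (l : ℕ) :
    image.ι (d (l + 1)) ≫ factorThruImage (d l) = 0 := by
  rw [← cancel_epi (factorThruImage (d (l + 1))), ← Category.assoc, image.fac,
    comp_factorThruImage d hd, comp_zero]

/-- The images of an exact complex give short exact sequences. -/
lemma shortExact_image (l : ℕ) (h : (ShortComplex.mk _ _ (hd l)).Exact) :
    (ShortComplex.mk _ _ (imageι_comp_factorThruImage d hd l)).ShortExact := by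
  have h₂ : (ShortComplex.mk _ _ (comp_factorThruImage d hd l)).Exact := by
    let φ : ShortComplex.mk _ _ (comp_factorThruImage d hd l) ⟶ ShortComplex.mk _ _ (hd l) :=
      { τ₁ := 𝟙 _, τ₂ := 𝟙 _, τ₃ := image.ι (d l) }
    have : Epi φ.τ₁ := inferInstanceAs (Epi (𝟙 _))
    have : IsIso φ.τ₂ := inferInstanceAs (IsIso (𝟙 _))
    have : Mono φ.τ₃ := inferInstanceAs (Mono (image.ι (d l)))
    exact (ShortComplex.exact_iff_of_epi_of_isIso_of_mono φ).2 h
  let φ : ShortComplex.mk _ _ (comp_factorThruImage d hd l) ⟶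
      ShortComplex.mk _ _ (imageι_comp_factorThruImage d hd l) :=
    { τ₁ := factorThruImage (d (l + 1)), τ₂ := 𝟙 _, τ₃ := 𝟙 _ }
  have : Epi φ.τ₁ := inferInstanceAs (Epi (factorThruImage _))
  have : IsIso φ.τ₂ := inferInstanceAs (IsIso (𝟙 _))
  have : Mono φ.τ₃ := inferInstanceAs (Mono (𝟙 _))
  exact { exact := (ShortComplex.exact_iff_of_epi_of_isIso_of_mono φ).1 h₂
          mono_f := inferInstanceAs (Mono (image.ι _))
          epi_g := inferInstanceAs (Epi (factorThruImage _)) }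

lemma map_factorThruImage_comp (l q : ℕ) :
    (functor k G q).map (factorThruImage (d l)) ≫ (functor k G q).map (image.ι (d l)) =
      (functor k G q).map (d l) := by
  rw [← Functor.map_comp, image.fac]

section Stability

variable {m n : ℕ}
  (hex : ∀ l, l + 2 ≤ n → (ShortComplex.mk _ _ (hd l)).Exact)
  (heven : ∀ q l, q < m → Even l → 2 * q + l < n → IsIso ((functor k G q).map (d l)))

include hd hex heven

omit hex in
-- For `l` even, the isomorphism `H_q(d l)` factors through the given epimorphism, forcing both
-- factors to be isomorphisms. For `l` odd, `H_q(d (l + 1))` is an isomorphism whose composite with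
-- that epimorphism is zero, so `H_q` of the image vanishes. The term `l % 2` pays for using `l + 1`
-- when `l` is odd.
lemma mono_map_imageι_of_epi (q l : ℕ) (hq : q < m) (hl : 2 * q + l + l % 2 < n)
    (hepi : Epi ((functor k G q).map (factorThruImage (d l)))) :
    Mono ((functor k G q).map (image.ι (d l))) := by
  rcases Nat.even_or_odd l with he | ho
  · have := heven q l hq he (by omega)
    have hfac := map_factorThruImage_comp d l q
    have := mono_of_mono_fac hfac
    have := isIso_of_mono_of_epi ((functor k G q).map (factorThruImage (d l)))
    rw [← IsIso.eq_inv_comp] at hfac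
    rw [hfac]
    infer_instance
  · have := heven q (l + 1) hq ho.add_one (by have := Nat.odd_iff.1 ho; omega)
    have hz : (functor k G q).map (factorThruImage (d l)) = 0 := by
      rw [← cancel_epi ((functor k G q).map (d (l + 1))), ← Functor.map_comp,
        comp_factorThruImage d hd, Functor.map_zero, comp_zero]
    exact ⟨fun _ _ _ => (IsZero.of_epi_eq_zero _ hz).eq_of_tgt _ _⟩

/-- Injectivity in degree `q` at `l + 1` kills the connecting map from degree `q + 1` at `l`, giving
the epimorphism needed there. In degree `0` right exactness suffices. -/
lemma mono_map_imageι (q l : ℕ) (hq : q < m) (hl : 2 * q + l + l % 2 < n) :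
    Mono ((functor k G q).map (image.ι (d l))) := by
  induction q generalizing l with
  | zero =>
    exact mono_map_imageι_of_epi d hd heven 0 l hq hl (epi_map_0_of_epi (factorThruImage (d l)))
  | succ q ih =>
    exact mono_map_imageι_of_epi d hd heven (q + 1) l hq hl
      (epi_functor_map_succ_of_mono (shortExact_image d hd l (hex l (by omega))) q
        (ih (l + 1) (by omega) (by omega)))

/-- The inductive step of homological stability: in an exact complex of representations whose
differentials alternately induce isomorphisms and zero on homology in low degrees, the last
differential induces an isomorphism one degree higher. -/
theorem isIso_map_differential_zero [Epi (d 0)] (hm : 0 < m) (hmn : 2 * m < n)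
    (hodd : (functor k G m).map (d 1) = 0) : IsIso ((functor k G m).map (d 0)) := by
  obtain ⟨q, rfl⟩ : ∃ q, m = q + 1 := ⟨m - 1, by omega⟩
  have : Epi (image.ι (d 0)) := epi_of_epi_fac (image.fac (d 0))
  have : IsIso (image.ι (d 0)) := isIso_of_mono_of_epi _
  rw [← map_factorThruImage_comp]
  have h₀ := shortExact_image d hd 0 (hex 0 (by omega))
  have h₁ := shortExact_image d hd 1 (hex 1 (by omega))
  -- The two uses of `mono_map_imageι`, at `l = 1` and `l = 2`, both require exactly `2 * q + 2 <
  -- n`, that is `2 * m < n`.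
  have : Epi ((functor k G (q + 1)).map (factorThruImage (d 0))) :=
    epi_functor_map_succ_of_mono h₀ q (mono_map_imageι d hd hex heven q 1 (by omega) (by omega))
  have : Epi ((functor k G (q + 1)).map (factorThruImage (d 1))) :=
    epi_functor_map_succ_of_mono h₁ q (mono_map_imageι d hd hex heven q 2 (by omega) (by omega))
  have hz : (functor k G (q + 1)).map (image.ι (d 1)) = 0 := by
    rw [← cancel_epi ((functor k G (q + 1)).map (factorThruImage (d 1))),
      map_factorThruImage_comp, hodd, comp_zero]
  have : Mono ((functor k G (q + 1)).map (factorThruImage (d 0))) :=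
    mono_functor_map_of_eq_zero h₀ (q + 1) hz
  have := isIso_of_mono_of_epi ((functor k G (q + 1)).map (factorThruImage (d 0)))
  infer_instance

end Stability

end groupHomology

/-! ### The complex of injective words as representations. -/

section InjectiveWordsRep

open Finsupp

variable {α : Type}

/-- Deleting the `i`-th letter of an injective word. -/
def wordFace {l : ℕ} (i : Fin (l + 1)) (w : Fin (l + 1) ↪ α) : Fin l ↪ α :=
  i.succAboveEmb.trans w

/-- The representation of the permutations of `α` on chains of injective words of length `l`. -/
noncomputable abbrev injectiveWordsRep (α : Type) (l : ℕ) : Rep ℤ (Equiv.Perm α) :=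
  Rep.permuted (Fin l ↪ α) (Rep.trivial ℤ (Equiv.Perm α) ℤ)

/-- The morphism of representations induced by deleting the `i`-th letter. -/
noncomputable def wordFaceHom (α : Type) {l : ℕ} (i : Fin (l + 1)) :
    injectiveWordsRep α (l + 1) ⟶ injectiveWordsRep α l :=
  Rep.permutedMapDomain (wordFace i) (fun _ _ => rfl) _

/-- The differential of the complex of injective words. -/
noncomputable def injectiveWordsDifferential (α : Type) (l : ℕ) :
    injectiveWordsRep α (l + 1) ⟶ injectiveWordsRep α l :=
  ∑ i : Fin (l + 1), ((-1 : ℤ) ^ (i : ℕ)) • wordFaceHom α i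

/-- The chain of lists underlying a chain of injective words. -/
noncomputable def toListChain (α : Type) (l : ℕ) : ((Fin l ↪ α) →₀ ℤ) →ₗ[ℤ] (List α →₀ ℤ) :=
  lmapDomain ℤ ℤ fun w => List.ofFn w

lemma toListChain_injective (α : Type) (l : ℕ) : Function.Injective (toListChain α l) :=
  mapDomain_injective fun _ _ h => DFunLike.coe_injective (List.ofFn_injective h)

lemma range_toListChain [Fintype α] (l : ℕ) :
    LinearMap.range (toListChain α l) = injectiveWords (Finset.univ : Finset α) l := by
  rw [LinearMap.range_eq_map, ← supported_univ, toListChain, lmapDomain_supported, injectiveWords]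
  congr 1
  ext w
  simp only [Set.image_univ, Set.mem_range, Finset.mem_univ, implies_true, true_and]
  constructor
  · rintro ⟨e, rfl⟩
    exact ⟨List.nodup_ofFn.2 e.injective, by simp⟩
  · rintro ⟨hw, rfl⟩
    exact ⟨⟨w.get, List.nodup_iff_injective_get.1 hw⟩, List.ofFn_get w⟩

lemma wordBoundarySingle_ofFn {l : ℕ} (w : Fin (l + 1) → α) :
    wordBoundarySingle (List.ofFn w) =
      ∑ i : Fin (l + 1), ((-1 : ℤ) ^ (i : ℕ)) • single (List.ofFn (w ∘ i.succAbove)) (1 : ℤ) := by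
  induction l with
  | zero => simp [wordBoundarySingle]
  | succ l ih =>
    rw [List.ofFn_succ, wordBoundarySingle, ih, Fin.sum_univ_succ (n := l + 1), map_sum, sub_eq_add_neg,
      ← Finset.sum_neg_distrib]
    congr 1
    · simp [Function.comp_def]
    · refine Finset.sum_congr rfl fun i _ => ?_
      rw [map_smul, wordPrefix_single, List.ofFn_succ (f := w ∘ i.succ.succAbove)]
      simp [pow_succ, Function.comp_def]

lemma injectiveWordsDifferential_single {l : ℕ} (w : Fin (l + 1) ↪ α) (c : ℤ) :
    (injectiveWordsDifferential α l).hom (single w c) =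
      ∑ i : Fin (l + 1), ((-1 : ℤ) ^ (i : ℕ)) • single (wordFace i w) c := by
  let ev : (injectiveWordsRep α (l + 1) ⟶ injectiveWordsRep α l) →+ injectiveWordsRep α l :=
    AddMonoidHom.mk' (fun f => f.hom (single w c)) fun _ _ => rfl
  refine (map_sum ev _ _).trans (Finset.sum_congr rfl fun i _ => ?_)
  refine (map_zsmul ev _ _).trans (congrArg _ ?_)
  exact Rep.permutedMapDomain_single (wordFace i) (fun _ _ => rfl)
    (Rep.trivial ℤ (Equiv.Perm α) ℤ) w c

lemma toListChain_differential (l : ℕ) (x : (Fin (l + 1) ↪ α) →₀ ℤ) :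
    toListChain α l ((injectiveWordsDifferential α l).hom x) =
      wordBoundary (toListChain α (l + 1) x) := by
  have h : toListChain α l ∘ₗ (injectiveWordsDifferential α l).hom.toLinearMap =
      wordBoundary ∘ₗ toListChain α (l + 1) := by
    apply lhom_ext
    intro w c
    change toListChain α l ((injectiveWordsDifferential α l).hom (single w c)) =
      wordBoundary (toListChain α (l + 1) (single w c))
    rw [injectiveWordsDifferential_single, map_sum]
    simp only [map_smul, toListChain, lmapDomain_apply, mapDomain_single, wordBoundary_single,
      wordBoundarySingle_ofFn, Finset.smul_sum]
    refine Finset.sum_congr rfl fun i _ => ?_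
    have : single (List.ofFn (wordFace i w)) c =
        c • single (List.ofFn (w ∘ i.succAbove)) (1 : ℤ) := by
      rw [smul_single, smul_eq_mul, mul_one]
      rfl
    rw [smul_comm, ← this]
  exact LinearMap.congr_fun h x

lemma injectiveWordsDifferential_comp (α : Type) (l : ℕ) :
    injectiveWordsDifferential α (l + 1) ≫ injectiveWordsDifferential α l = 0 := by
  apply Rep.hom_ext
  apply Representation.IntertwiningMap.ext
  refine LinearMap.ext fun x => ?_
  apply toListChain_injective α l
  change toListChain α l ((injectiveWordsDifferential α l).hom
    ((injectiveWordsDifferential α (l + 1)).hom x)) = toListChain α l 0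
  rw [toListChain_differential, toListChain_differential, wordBoundary_wordBoundary, map_zero]

lemma exists_differential_eq [Fintype α] {l : ℕ} (hl : l + 1 ≤ Fintype.card α)
    (x : (Fin l ↪ α) →₀ ℤ) (hx : wordBoundary (toListChain α l x) = 0) :
    ∃ y : (Fin (l + 1) ↪ α) →₀ ℤ, (injectiveWordsDifferential α l).hom y = x := by
  obtain ⟨z, hz, hdz⟩ := injectiveWords_exact (Finset.univ : Finset α) hl
    (by rw [← range_toListChain]; exact ⟨x, rfl⟩) hx
  rw [← range_toListChain] at hz
  obtain ⟨y, rfl⟩ := hz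
  refine ⟨y, toListChain_injective α l ?_⟩
  rw [toListChain_differential]
  exact hdz

lemma injectiveWordsRep_exact [Fintype α] (l : ℕ) (hl : l + 2 ≤ Fintype.card α) :
    (ShortComplex.mk _ _ (injectiveWordsDifferential_comp α l)).Exact := by
  refine Rep.exact_of_forall_exists fun x hx => ?_
  refine exists_differential_eq (l := l + 1) hl x ?_
  refine (toListChain_differential l x).symm.trans ?_
  exact (congrArg (toListChain α l) hx).trans (map_zero _)

/-- This is exactness at the empty word, whose boundary is zero. -/
lemma epi_injectiveWordsDifferential_zero [Fintype α] [Nonempty α] :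
    Epi (injectiveWordsDifferential α 0) := by
  rw [Rep.epi_iff_surjective]
  intro x
  refine exists_differential_eq (Nat.succ_le_iff.2 Fintype.card_pos) x ?_
  change wordBoundary (lmapDomain ℤ ℤ (fun w : Fin 0 ↪ α => List.ofFn w) x) = 0
  induction x using Finsupp.induction_linear with
  | zero => simp
  | add x y hx hy => simp only [map_add]; rw [hx, hy, add_zero]
  | single w c => simp [wordBoundarySingle]

end InjectiveWordsRep

/-! ### Faces of words and the stabilization maps. -/

section Stabilization

open groupHomology

/-- The injective word `k+1, …, n` consisting of the last letters. -/
def lastLetters {k l n : ℕ} (h : k + l = n) : Fin l ↪ Fin n :=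
  ⟨fun i => ⟨k + i, by omega⟩, fun i j hij => Fin.ext (by simpa using hij)⟩

@[simp] lemma lastLetters_val {k l n : ℕ} (h : k + l = n) (i : Fin l) :
    (lastLetters h i : ℕ) = k + i := rfl

lemma symInclusion_injective {k n : ℕ} (h : k ≤ n) : Function.Injective (symInclusion h) :=
  Equiv.Perm.viaEmbeddingHom_injective _

lemma symInclusion_smul_lastLetters {k l n : ℕ} (h : k + l = n) (σ : SymGroup k) :
    symInclusion (Nat.le.intro h) σ • lastLetters h = lastLetters h := by
  ext i
  rw [Function.Embedding.smul_apply, Equiv.Perm.smul_def,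
    symInclusion_of_le _ _ _ (Nat.le_add_right k i)]

lemma exists_symInclusion_eq {k l n : ℕ} (h : k + l = n) (g : SymGroup n)
    (hg : g • lastLetters h = lastLetters h) : ∃ σ, symInclusion (Nat.le.intro h) σ = g := by
  have hfix : ∀ i : Fin n, k ≤ i → g i = i := by
    intro i hi
    have := DFunLike.congr_fun hg (⟨i - k, by omega⟩ : Fin l)
    have hi' : lastLetters h ⟨i - k, by omega⟩ = i := Fin.ext (by simp; omega)
    rwa [Function.Embedding.smul_apply, hi', Equiv.Perm.smul_def] at this
  have hlt : ∀ g' : SymGroup n, (∀ i : Fin n, k ≤ i → g' i = i) → ∀ i : Fin n, (i : ℕ) < k →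
      (g' i : ℕ) < k := by
    intro g' hg' i hi
    by_contra hc
    have := g'.injective (hg' (g' i) (not_lt.1 hc))
    omega
  have hfix' : ∀ i : Fin n, k ≤ i → g⁻¹ i = i := fun i hi => by
    rw [Equiv.Perm.inv_eq_iff_eq, hfix i hi]
  have hk : k ≤ n := Nat.le.intro h
  refine ⟨⟨fun i => ⟨g (Fin.castLE hk i), hlt g hfix _ i.2⟩,
    fun i => ⟨g⁻¹ (Fin.castLE hk i), hlt g⁻¹ hfix' _ i.2⟩, fun i => ?_, fun i => ?_⟩, ?_⟩
  · apply Fin.ext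
    change (g⁻¹ (g (Fin.castLE hk i)) : ℕ) = i
    simp
  · apply Fin.ext
    change (g (g⁻¹ (Fin.castLE hk i)) : ℕ) = i
    simp
  · ext i
    by_cases hi : (i : ℕ) < k
    · have := symInclusion_castLE hk ⟨fun i => ⟨g (Fin.castLE hk i), hlt g hfix _ i.2⟩,
        fun i => ⟨g⁻¹ (Fin.castLE hk i), hlt g⁻¹ hfix' _ i.2⟩, fun i => Fin.ext (by
          change (g⁻¹ (g (Fin.castLE hk i)) : ℕ) = i
          simp), fun i => Fin.ext (by
          change (g (g⁻¹ (Fin.castLE hk i)) : ℕ) = i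
          simp)⟩ ⟨i, hi⟩
      exact congrArg Fin.val this
    · rw [symInclusion_of_le _ _ _ (not_lt.1 hi), hfix i (not_lt.1 hi)]

lemma exists_smul_lastLetters_eq {k l n : ℕ} (h : k + l = n) (w : Fin l ↪ Fin n) :
    ∃ g : SymGroup n, g • lastLetters h = w := by
  have : MulAction.IsMultiplyPretransitive (SymGroup n) (Fin n) l :=
    Equiv.Perm.isMultiplyPretransitive (Fin n) l
  exact MulAction.exists_smul_eq _ _ _

/-- The coefficient morphism `ℤ → ℤ[words]` picking out the word formed by the last letters. -/
noncomputable def lastLettersHom {k l n : ℕ} (h : k + l = n) :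
    Rep.trivial ℤ (SymGroup k) ℤ ⟶
      Rep.res (symInclusion (Nat.le.intro h)) (injectiveWordsRep (Fin n) l) :=
  Rep.toPermuted (Fin l ↪ Fin n) (symInclusion (Nat.le.intro h)) (lastLetters h)
    (symInclusion_smul_lastLetters h) (Rep.trivial ℤ (SymGroup n) ℤ)

instance isIso_map_lastLettersHom {k l n : ℕ} (h : k + l = n) (q : ℕ) :
    IsIso (map (symInclusion (Nat.le.intro h)) (lastLettersHom h) q) :=
  isIso_map_toPermuted (symInclusion (Nat.le.intro h)) (Fin l ↪ Fin n) (lastLetters h)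
    (symInclusion_smul_lastLetters h) (symInclusion_injective _) (exists_smul_lastLetters_eq h)
    (exists_symInclusion_eq h) (Rep.trivial ℤ (SymGroup n) ℤ) q

lemma symInclusion_comp {j k n : ℕ} (h₁ : j ≤ k) (h₂ : k ≤ n) :
    (symInclusion h₂).comp (symInclusion h₁) = symInclusion (h₁.trans h₂) := by
  ext σ i
  rw [MonoidHom.comp_apply]
  by_cases hj : (i : ℕ) < j
  · have e : i = Fin.castLE (h₁.trans h₂) ⟨i, hj⟩ := rfl
    have e' : Fin.castLE (h₁.trans h₂) ⟨i, hj⟩ = Fin.castLE h₂ (Fin.castLE h₁ ⟨i, hj⟩) := rfl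
    rw [e, symInclusion_castLE, e', symInclusion_castLE, symInclusion_castLE]
    rfl
  · rw [symInclusion_of_le (h₁.trans h₂) _ _ (not_lt.1 hj)]
    by_cases hk : (i : ℕ) < k
    · have e : i = Fin.castLE h₂ ⟨i, hk⟩ := rfl
      rw [e, symInclusion_castLE, symInclusion_of_le h₁ _ _ (not_lt.1 hj)]
    · rw [symInclusion_of_le h₂ _ _ (not_lt.1 hk)]

/-- A permutation of the last letters moving the word of the last `l` letters to a face of the
word of the last `l + 1` letters. -/
lemma exists_smul_lastLetters_eq_wordFace {k l n : ℕ} (h : k + (l + 1) = n) (i : Fin (l + 1)) :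
    ∃ g : SymGroup n, g • lastLetters (k := k + 1) (l := l) (by omega) =
        wordFace i (lastLetters h) ∧
      ∀ σ : SymGroup k, g * symInclusion (Nat.le.intro h) σ * g⁻¹ =
        symInclusion (Nat.le.intro h) σ := by
  have : MulAction.IsMultiplyPretransitive (SymGroup (l + 1)) (Fin (l + 1)) l :=
    Equiv.Perm.isMultiplyPretransitive (Fin (l + 1)) l
  -- The word of the last `l` letters omits position `0` of the longer word; `τ` permutes positions
  -- so that `i` is omitted instead. Acting on the last letters only, it commutes with `Σ_k`.
  obtain ⟨τ, hτ⟩ := MulAction.exists_smul_eq (SymGroup (l + 1)) (Fin.succEmb l) i.succAboveEmb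
  refine ⟨τ.viaEmbedding (lastLetters h), ?_, fun σ => ?_⟩
  · apply DFunLike.ext
    intro j
    have e : lastLetters (k := k + 1) (l := l) (n := n) (by omega) j = lastLetters h j.succ :=
      Fin.ext (by simp; omega)
    rw [Function.Embedding.smul_apply, Equiv.Perm.smul_def, e, Equiv.Perm.viaEmbedding_apply]
    exact congrArg _ (DFunLike.congr_fun hτ j)
  · have hd : Equiv.Perm.Disjoint (τ.viaEmbedding (lastLetters h))
        (symInclusion (Nat.le.intro h) σ) := by
      intro x
      by_cases hx : (x : ℕ) < k
      · left
        apply Equiv.Perm.viaEmbedding_apply_of_notMem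
        rintro ⟨j, rfl⟩
        simp at hx
      · right
        exact symInclusion_of_le _ _ _ (not_lt.1 hx)
    rw [hd.commute.eq, mul_inv_cancel_right]

/-- The right side is independent of `i`: on coefficients the faces differ by the action of some `g`
centralizing `Σ_k`, and conjugation by `g` is trivial on homology. -/
lemma map_lastLettersHom_comp_wordFaceHom {k l n : ℕ} (h : k + (l + 1) = n) (i : Fin (l + 1))
    (q : ℕ) :
    map (symInclusion (Nat.le.intro h)) (lastLettersHom h) q ≫
        map (MonoidHom.id _) (wordFaceHom (Fin n) i) q =
      integralHomologyMap (symInclusion (Nat.le_succ k)) q ≫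
        map (symInclusion (Nat.le.intro (show k + 1 + l = n by omega)))
          (lastLettersHom (show k + 1 + l = n by omega)) q := by
  obtain ⟨g, hg, hcomm⟩ := exists_smul_lastLetters_eq_wordFace h i
  rw [← Category.comp_id (map _ (lastLettersHom (show k + 1 + l = n by omega)) q),
    ← map_conj g (injectiveWordsRep (Fin n) l) q, integralHomologyMap, ← map_comp, ← map_comp,
    ← map_comp]
  refine map_congr ?_ ?_ q
  · ext1 σ
    change symInclusion _ σ = g * (symInclusion _).comp (symInclusion _) σ * g⁻¹
    rw [symInclusion_comp, hcomm]
  · refine LinearMap.ext fun c => ?_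
    change Finsupp.mapDomain (wordFace i) (Finsupp.single (lastLetters h) c) =
      Rep.permutedRepresentation _ (Rep.trivial ℤ (SymGroup n) ℤ) g (Finsupp.single _ c)
    rw [Rep.permutedRepresentation_single, hg, Finsupp.mapDomain_single]
    rfl

lemma map_lastLettersHom_comp_differential {k l n : ℕ} (h : k + (l + 1) = n) (q : ℕ) :
    map (symInclusion (Nat.le.intro h)) (lastLettersHom h) q ≫
        (functor ℤ (SymGroup n) q).map (injectiveWordsDifferential (Fin n) l) =
      (∑ i : Fin (l + 1), (-1 : ℤ) ^ (i : ℕ)) •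
        (integralHomologyMap (symInclusion (Nat.le_succ k)) q ≫
          map (symInclusion (Nat.le.intro (show k + 1 + l = n by omega)))
            (lastLettersHom (show k + 1 + l = n by omega)) q) := by
  rw [injectiveWordsDifferential, Functor.map_sum, Finset.sum_smul]
  refine (Preadditive.comp_sum _ _ _).trans (Finset.sum_congr rfl fun i _ => ?_)
  rw [Functor.map_zsmul]
  refine (Preadditive.comp_zsmul _ _ _).trans ?_
  rw [← map_lastLettersHom_comp_wordFaceHom h i q]
  rfl

end Stabilization

/-! ### The induction proving stability. -/

section NakaokaStability

open groupHomology

/-- For `l` even the `l + 1` alternating signs sum to `1`, so the Shapiro isomorphisms turn the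
differential into stabilization. -/
lemma isIso_functor_map_differential_iff {k l n : ℕ} (h : k + (l + 1) = n) (hl : Even l) (q : ℕ) :
    IsIso ((functor ℤ (SymGroup n) q).map (injectiveWordsDifferential (Fin n) l)) ↔
      IsIso (integralHomologyMap (symInclusion (Nat.le_succ k)) q) := by
  have hcomp := map_lastLettersHom_comp_differential h q
  rw [Fin.sum_neg_one_pow, if_neg (by simpa [Nat.even_add_one] using hl), one_smul] at hcomp
  constructor
  · intro hiso
    have : IsIso (integralHomologyMap (symInclusion (Nat.le_succ k)) q ≫
        map (symInclusion (Nat.le.intro (show k + 1 + l = n by omega)))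
          (lastLettersHom (show k + 1 + l = n by omega)) q) :=
      hcomp ▸ IsIso.comp_isIso' (isIso_map_lastLettersHom h q) hiso
    exact IsIso.of_isIso_comp_right _ (map (symInclusion (Nat.le.intro (show k + 1 + l = n by omega)))
      (lastLettersHom (show k + 1 + l = n by omega)) q)
  · intro hiso
    have : IsIso (map (symInclusion (Nat.le.intro h)) (lastLettersHom h) q ≫
        (functor ℤ (SymGroup n) q).map (injectiveWordsDifferential (Fin n) l)) :=
      hcomp ▸ IsIso.comp_isIso' hiso (isIso_map_lastLettersHom _ q)
    exact IsIso.of_isIso_comp_left (map (symInclusion (Nat.le.intro h)) (lastLettersHom h) q) _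

lemma functor_map_differential_one {k n : ℕ} (h : k + 2 = n) (q : ℕ) :
    (functor ℤ (SymGroup n) q).map (injectiveWordsDifferential (Fin n) 1) = 0 := by
  have hcomp := map_lastLettersHom_comp_differential (l := 1) h q
  rw [Fin.sum_neg_one_pow, if_pos (by decide), zero_smul] at hcomp
  exact (cancel_epi (map (symInclusion (Nat.le.intro h)) (lastLettersHom h) q)).1
    (hcomp.trans Limits.comp_zero.symm)

lemma isIso_integralHomologyMap_zero {G H : Type} [Group G] [Group H] (f : G →* H) :
    IsIso (integralHomologyMap f 0) := by
  have hG : IsIso (H0π (Rep.trivial ℤ G ℤ)) :=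
    H0IsoOfIsTrivial_inv_eq_π (Rep.trivial ℤ G ℤ) ▸ inferInstance
  have hH : IsIso (H0π (Rep.trivial ℤ H ℤ)) :=
    H0IsoOfIsTrivial_inv_eq_π (Rep.trivial ℤ H ℤ) ▸ inferInstance
  have h : H0π (Rep.trivial ℤ G ℤ) ≫ integralHomologyMap f 0 = H0π (Rep.trivial ℤ H ℤ) :=
    H0π_comp_map f (trivialToRes f)
  have : IsIso (H0π (Rep.trivial ℤ G ℤ) ≫ integralHomologyMap f 0) := h ▸ hH
  exact IsIso.of_isIso_comp_left (H0π (Rep.trivial ℤ G ℤ)) _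

theorem isIso_integralHomologyMap_symInclusion_succ (m k : ℕ) (hmk : 2 * m < k + 1) :
    IsIso (integralHomologyMap (symInclusion (Nat.le_succ k)) m) := by
  induction m using Nat.strong_induction_on generalizing k with
  | _ m ih =>
    rcases Nat.eq_zero_or_pos m with rfl | hm
    · exact isIso_integralHomologyMap_zero _
    rw [← isIso_functor_map_differential_iff (l := 0) (n := k + 1) rfl (by decide) m]
    have := epi_injectiveWordsDifferential_zero (α := Fin (k + 1))
    refine isIso_map_differential_zero (injectiveWordsDifferential (Fin (k + 1)))
      (injectiveWordsDifferential_comp _) (n := k + 1)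
      (fun l hl => injectiveWordsRep_exact l (by simpa using hl)) ?_ hm hmk
      -- Since `m` is positive, `2 * m < k + 1` gives `1 ≤ k`, so the subtraction is not truncated.
      (functor_map_differential_one (k := k - 1) (by omega) m)
    -- The bound `2 * q + l < k + 1` gives `l ≤ k` and is the stable range for `Σ_{k-l} → Σ_{k-l+1}`
    -- in degree `q`.
    intro q l hq hl hlt
    exact (isIso_functor_map_differential_iff (k := k - l) (by omega) hl q).2
      (ih q hq (k - l) (by omega))

end NakaokaStability

/-- Nakaoka stability: for `m < n / 2` the standard inclusion `Σ_{n-1} → Σ_n` induces an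
isomorphism `H_m(Σ_{n-1}) ≅ H_m(Σ_n)` on integral homology. (`m < n / 2` forces `1 ≤ n`.) -/
theorem theorem2 (m n : ℕ) (hmn : (m : ℚ) < (n : ℚ) / 2) :
    IsIso (integralHomologyMap (symInclusion (Nat.sub_le n 1)) m) := by
  have h : 2 * m < n := by
    rw [lt_div_iff₀ (by norm_num), mul_comm] at hmn
    exact_mod_cast hmn
  obtain ⟨k, rfl⟩ : ∃ k, n = k + 1 := ⟨n - 1, by omega⟩
  exact isIso_integralHomologyMap_symInclusion_succ m k h
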